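/- A barycentric algebra is a set $B$ with binary operations $+_a$, $a\in[0,1]$, such that for all $x,y,z\in B$ and $a,b\in[0,1]$: $x+_1y=x$; $x+_ax=x$; $x+_ay=y+_{1-a}x$; and $(x+_ay)+_bz=x+_{ab}\bigl(y+_{\frac{(1-a)b}{1-ab}}z\bigr)$ if $a<1$ and $b<1$. It is semitopological if $B$ carries a topology for which $(x,a,y)\mapsto x+_ay$ is separately continuous on $B\times[0,1]\times B$, where $[0,1]$ has its usual metric topology. Every topological space is preordered by specialization: $x\le y$ iff every open neighborhood of $x$ contains $y$; write $\uparrow A=\{z\mid \exists x\in A,\ x\le z\}$. A semitopological barycentric algebra $B$ is consistent if for all open $U,V\subseteq B$ and every open $I\subseteq[0,1]$, the set $\uparrow\{x+_ay\mid x\in U,\ y\in V,\ a\in I\}$ is open; it is pointed if it has a distinguished element $\bot$ that is least for the specialization preorder. A topological space is a c-space if for every point $x$ and every open neighborhood $U$ of $x$ there is $y\in U$ such that $x$ lies in the interior of $\uparrow\{y\}$. A map $\Lambda\colon B\to[0,\infty]$ is affine if $\Lambda(x+_ay)=a\Lambda(x)+(1-a)\Lambda(y)$ for all $x,y\in B$,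 $a\in[0,1]$ (with $0\cdot\infty=0$); if $B$ is pointed, $\Lambda$ is linear if it is affine and $\Lambda(x+_a\bot)=a\Lambda(x)$ for all $x\in B$, $a\in[0,1]$. Let $B^\dagger$ be the set of affine lower semicontinuous maps $B\to[0,\infty]$ and, for $B$ pointed, $B^*$ the set of linear lower semicontinuous ones, each with the weak$^*$Scott topology, generated by the sets $\{\Lambda\mid\Lambda(x)>r\}$ with $x\in B$ and $0<r<\infty$. A space is stably compact if it is sober (including $T_0$), locally compact (every point has a base of compact neighborhoods), coherent (the intersection of any two compact saturated subsets is compact, where a set is saturated if it is the intersection of its open neighborhoods) and compact. Theorem (Plotkin–Banach–Alaoglu). For every consistent semitopological barycentric algebra $B$ whose underlying topological space is a c-space, $B^\dagger$ is stably compact. If $B$ is also pointed, then $B^*$ is stably compact. -/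

import Mathlib

open scoped unitInterval ENNReal NNReal

/-- A barycentric algebra: a set with binary operations `mix a x y`, written `x +_a y`,
for `a ∈ [0, 1]`. The fourth law is `(x +_a y) +_b z = x +_{ab} (y +_c z)` for
`a < 1`, `b < 1`, where `c = (1 - a) b / (1 - a b)`. -/
class BarycentricAlgebra (B : Type*) where
  mix : I → B → B → B
  mix_one : ∀ x y : B, mix 1 x y = x
  mix_self : ∀ (a : I) (x : B), mix a x x = x
  mix_symm : ∀ (a : I) (x y : B), mix a x y = mix (σ a) y x
  mix_assoc : ∀ (a b c : I) (x y z : B), a < 1 → b < 1 →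
    (c : ℝ) = (1 - a) * b / (1 - a * b) →
    mix b (mix a x y) z = mix (a * b) x (mix c y z)

namespace BarycentricAlgebra

/-- A barycentric algebra with a topology is semitopological when `(x, a, y) ↦ x +_a y` is
separately continuous on `B × [0, 1] × B`, where `[0, 1]` has its metric topology. -/
class IsSemitopological (B : Type*) [TopologicalSpace B] [BarycentricAlgebra B] : Prop where
  continuous_left : ∀ (a : I) (y : B), Continuous fun x : B => mix a x y
  continuous_weight : ∀ x y : B, Continuous fun a : I => mix a x y
  continuous_right : ∀ (a : I) (x : B), Continuous fun y : B => mix a x y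

/-- The set `U +_J V` of all `x +_a y` with `x ∈ U`, `y ∈ V`, `a ∈ J`. -/
def mixSet {B : Type*} [BarycentricAlgebra B] (J : Set I) (U V : Set B) : Set B :=
  {z | ∃ x ∈ U, ∃ y ∈ V, ∃ a ∈ J, mix a x y = z}

/-- Consistency: the upward closure of `U +_J V` is open for all open `U`, `V`, `J`.
The specialization preorder is `x ≤ y ↔ y ⤳ x`, and `nhdsKer A` is the upward closure of `A`
with respect to it (see `mem_nhdsKer_iff_specializes`). -/
def IsConsistent (B : Type*) [TopologicalSpace B] [BarycentricAlgebra B] : Prop :=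
  ∀ (U V : Set B) (J : Set I), IsOpen U → IsOpen V → IsOpen J → IsOpen (nhdsKer (mixSet J U V))

/-- `bot` makes `B` a pointed semitopological barycentric algebra: it is a least element of the
specialization preorder. -/
def IsPoint {B : Type*} [TopologicalSpace B] (bot : B) : Prop :=
  ∀ x : B, x ⤳ bot

/-- Affine maps to the cone `[0, ∞]`, in which `s +_a t = a s + (1 - a) t`
(with `0 * ∞ = 0`). -/
def IsAffineMap {B : Type*} [BarycentricAlgebra B] (f : B → ℝ≥0∞) : Prop :=
  ∀ (a : I) (x y : B),
    f (mix a x y) = ENNReal.ofReal (a : ℝ) * f x + ENNReal.ofReal (1 - (a : ℝ)) * f y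

/-- Linear maps from a pointed barycentric algebra to `[0, ∞]`: affine maps `f` with
`f (a • x) = a f x` for `a ∈ [0, 1]`, where `a • x = x +_a bot`. -/
def IsLinearMap {B : Type*} [BarycentricAlgebra B] (bot : B) (f : B → ℝ≥0∞) : Prop :=
  IsAffineMap f ∧ ∀ (a : I) (x : B), f (mix a x bot) = ENNReal.ofReal (a : ℝ) * f x

/-- The dual `B^†` of all affine lower semicontinuous maps from `B` to `[0, ∞]`. -/
def AffineDual (B : Type*) [TopologicalSpace B] [BarycentricAlgebra B] : Type _ :=
  {f : B → ℝ≥0∞ // IsAffineMap f ∧ LowerSemicontinuous f}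

/-- The dual `B^*` of all linear lower semicontinuous maps from `B`, pointed by `bot`,
to `[0, ∞]`. -/
def LinearDual (B : Type*) [TopologicalSpace B] [BarycentricAlgebra B] (bot : B) : Type _ :=
  {f : B → ℝ≥0∞ // IsLinearMap bot f ∧ LowerSemicontinuous f}

/-- The weak*Scott topology on `B^†`, generated by the sets `[x > r] = {f | f x > r}` with
`x ∈ B` and `0 < r < ∞`. -/
instance (B : Type*) [TopologicalSpace B] [BarycentricAlgebra B] :
    TopologicalSpace (AffineDual B) :=
  TopologicalSpace.generateFrom
    {S | ∃ (x : B) (r : ℝ≥0), 0 < r ∧ S = {f : AffineDual B | (r : ℝ≥0∞) < f.1 x}}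

/-- The weak*Scott topology on `B^*`. -/
instance (B : Type*) [TopologicalSpace B] [BarycentricAlgebra B] (bot : B) :
    TopologicalSpace (LinearDual B bot) :=
  TopologicalSpace.generateFrom
    {S | ∃ (x : B) (r : ℝ≥0), 0 < r ∧ S = {f : LinearDual B bot | (r : ℝ≥0∞) < f.1 x}}

end BarycentricAlgebra

/-- A c-space: for every open neighborhood `U` of a point `x` there is `y ∈ U` such that `x` is
in the interior of the set of points above `y` in the specialization preorder. -/
def IsCSpace (X : Type*) [TopologicalSpace X] : Prop :=
  ∀ (x : X) (U : Set X), IsOpen U → x ∈ U → ∃ y ∈ U, x ∈ interior {z : X | z ⤳ y}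

/-- A space is coherent when the intersection of any two compact saturated subsets is compact;
a set is saturated when it is the intersection of its (open) neighborhoods. -/
def IsCoherentSpace (X : Type*) [TopologicalSpace X] : Prop :=
  ∀ K L : Set X, IsCompact K → nhdsKer K = K → IsCompact L → nhdsKer L = L → IsCompact (K ∩ L)

/-- Stably compact spaces: sober (that is, `T₀` and quasi-sober), locally compact (every point
has a base of compact neighborhoods), coherent and compact. -/
structure IsStablyCompact (X : Type*) [TopologicalSpace X] : Prop where
  t0 : T0Space X
  quasiSober : QuasiSober X
  locallyCompact : LocallyCompactSpace X
  coherent : IsCoherentSpace X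
  compact : CompactSpace X

/-! The cube `[0, ∞]^B` is compact Hausdorff, and the monotone affine maps form a closed subset `A`
(`isClosed_affineMonotone`). Sending `f` to `approxSup IsInteriorBelow f`, its largest lower
semicontinuous minorant, retracts `A` onto the dual: the c-space property makes it fix lower
semicontinuous maps, and consistency with separate continuity keeps it affine
(`isAffineMap_approxSup`).

This retraction is continuous from the product topology to the weak*Scott topology, so compact sets
in the dual arise as images of closed subsets of `A`. `IsWeakScott.isStablyCompact` derives stable
compactness from this. -/

open Set Topology TopologicalSpace

/-! ### Stable compactness of retracts of closed subsets of a cube -/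

section WeakRetract

variable {ι Y : Type*} [t : TopologicalSpace Y] {e : Y → ι → ℝ≥0∞}

/-- The topology of `Y` is generated by the sets `{y | r < e y x}` with `0 < r < ∞`. -/
def IsWeakScott (Y : Type*) {ι : Type*} [t : TopologicalSpace Y] (e : Y → ι → ℝ≥0∞) : Prop :=
  t = generateFrom {S | ∃ (x : ι) (r : ℝ≥0), 0 < r ∧ S = {y : Y | (r : ℝ≥0∞) < e y x}}

/-- The supremum of `f` over all points that `x` is related to. -/
noncomputable def approxSup (R : ι → ι → Prop) (f : ι → ℝ≥0∞) (x : ι) : ℝ≥0∞ :=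
  ⨆ y, ⨆ _ : R y x, f y

theorem lt_approxSup_iff {R : ι → ι → Prop} {f : ι → ℝ≥0∞} {x : ι} {r : ℝ≥0∞} :
    r < approxSup R f x ↔ ∃ y, R y x ∧ r < f y := by
  simp [approxSup, lt_iSup_iff]

theorem le_approxSup {R : ι → ι → Prop} {f : ι → ℝ≥0∞} {x y : ι} (h : R y x) :
    f y ≤ approxSup R f x :=
  le_iSup₂ (f := fun y (_ : R y x) => f y) y h

theorem approxSup_mono (R : ι → ι → Prop) {f g : ι → ℝ≥0∞} (h : f ≤ g) :
    approxSup R f ≤ approxSup R g :=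
  fun _ => iSup₂_mono fun y _ => h y

namespace IsWeakScott

theorem isOpen_lt (ht : IsWeakScott Y e) (x : ι) (r : ℝ≥0∞) : IsOpen {y : Y | r < e y x} := by
  have h : {y : Y | r < e y x} =
      ⋃ s : {s : ℝ≥0 // 0 < s ∧ r < s}, {y : Y | ((s : ℝ≥0) : ℝ≥0∞) < e y x} := by
    ext y
    simp only [mem_ofPred_eq, mem_iUnion]
    constructor
    · intro h
      obtain ⟨s, hs, hs'⟩ := ENNReal.lt_iff_exists_nnreal_btwn.1 h
      exact ⟨⟨s, by exact_mod_cast (zero_le.trans_lt hs), hs⟩, hs'⟩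
    · rintro ⟨⟨s, _, hs⟩, hs'⟩
      exact hs.trans hs'
  rw [h]
  refine isOpen_iUnion fun s => ?_
  have h' := isOpen_generateFrom_of_mem (g := {S | ∃ (x : ι) (r : ℝ≥0), 0 < r ∧
    S = {y : Y | (r : ℝ≥0∞) < e y x}}) ⟨x, s.1, s.2.1, rfl⟩
  rwa [← show t = _ from ht] at h'

theorem isTopologicalBasis (ht : IsWeakScott Y e) :
    IsTopologicalBasis ((fun f => ⋂₀ f) '' {f : Set (Set Y) | f.Finite ∧
      f ⊆ {S | ∃ (x : ι) (r : ℝ≥0), 0 < r ∧ S = {y : Y | (r : ℝ≥0∞) < e y x}}}) :=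
  isTopologicalBasis_of_subbasis ht

theorem specializes_iff (ht : IsWeakScott Y e) {y z : Y} : y ⤳ z ↔ e z ≤ e y := by
  constructor
  · intro h x
    refine le_of_forall_lt fun r hr => ?_
    exact h.mem_open (ht.isOpen_lt x r) hr
  · intro h
    rw [specializes_iff_forall_open]
    intro s hs hz
    obtain ⟨_, ⟨F, ⟨-, hF⟩, rfl⟩, hzF, hFs⟩ := ht.isTopologicalBasis.exists_subset_of_mem_open hz hs
    refine hFs fun S hS => ?_
    obtain ⟨x, r, -, rfl⟩ := hF hS
    exact (hzF _ hS).out.trans_le (h x)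

/-- Continuity of `ρ`: the condition `r < approxSup R f x` is a union over `y` of the product-open
conditions `r < f y`. -/
theorem isCompact_image (ht : IsWeakScott Y e) {R : ι → ι → Prop} {Q : Set (ι → ℝ≥0∞)}
    (hQ : IsCompact Q) {ρ : (ι → ℝ≥0∞) → Y} (hρ : ∀ f ∈ Q, e (ρ f) = approxSup R f) :
    IsCompact (ρ '' Q) := by
  refine hQ.image_of_continuousOn ?_
  rw [continuousOn_iff_continuous_domRestrict]
  suffices h : Continuous[_, generateFrom {S | ∃ (x : ι) (r : ℝ≥0), 0 < r ∧
      S = {y : Y | (r : ℝ≥0∞) < e y x}}] (Q.domRestrict ρ) from (show t = _ from ht) ▸ h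
  refine continuous_generateFrom_iff.2 ?_
  rintro _ ⟨x, r, -, rfl⟩
  have : Q.domRestrict ρ ⁻¹' {y : Y | (r : ℝ≥0∞) < e y x} =
      ⋃ y, ⋃ _ : R y x, {f : Q | (r : ℝ≥0∞) < f.1 y} := by
    ext f
    simp [hρ f.1 f.2, lt_approxSup_iff]
  rw [this]
  refine isOpen_iUnion fun y => isOpen_iUnion fun _ => ?_
  exact _root_.isOpen_lt continuous_const ((continuous_apply y).comp continuous_subtype_val)

/-- The upper set generated by a compact set is closed in the product topology. -/
theorem isClosed_upper (ht : IsWeakScott Y e) {K : Set Y} (hK : IsCompact K) :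
    IsClosed {f : ι → ℝ≥0∞ | ∃ k ∈ K, e k ≤ f} := by
  refine isOpen_compl_iff.1 (isOpen_iff_mem_nhds.2 fun g hg => ?_)
  have h : ∀ k : K, ∃ x : ι, ∃ r : ℝ≥0∞, g x < r ∧ r < e k x := by
    intro k
    have : ¬ e k ≤ g := fun h => hg ⟨k, k.2, h⟩
    simp only [Pi.le_def, not_forall, not_le] at this
    obtain ⟨x, hx⟩ := this
    exact ⟨x, exists_between hx⟩
  choose x r hg' hk using h
  obtain ⟨F, hF⟩ := hK.elim_finite_subcover (fun k : K => {y : Y | r k < e y (x k)})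
    (fun k => ht.isOpen_lt _ _) fun k hkK => mem_iUnion.2 ⟨⟨k, hkK⟩, hk ⟨k, hkK⟩⟩
  have hN : (⋂ k ∈ F, {f : ι → ℝ≥0∞ | f (x k) < r k}) ∈ 𝓝 g := by
    refine (Filter.biInter_finset_mem F).2 fun k _ => ?_
    exact (_root_.isOpen_lt (continuous_apply (x k)) continuous_const).mem_nhds (hg' k)
  refine Filter.mem_of_superset hN ?_
  rintro f hf ⟨k, hkK, hkf⟩
  obtain ⟨j, hj, hjk⟩ := mem_iUnion₂.1 (hF hkK)
  have h1 : f (x j) < r j := mem_iInter₂.1 hf j hj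
  exact absurd (hkf (x j)) (not_le.2 (h1.trans hjk))

/-- The pointwise supremum of an irreducible set lies in its closure for the product topology. -/
theorem iSup_mem_closure_image (ht : IsWeakScott Y e) {C : Set Y} (hC : IsIrreducible C) :
    (fun x => ⨆ k ∈ C, e k x) ∈ closure (e '' C) := by
  classical
  rw [mem_closure_iff]
  intro o ho hgo
  obtain ⟨J, u, hu, hJ⟩ := isOpen_pi_iff.1 ho _ hgo
  have h : ∀ x ∈ J, ∃ V : Set Y, IsOpen V ∧ (C ∩ V).Nonempty ∧ ∀ k ∈ C ∩ V, e k x ∈ u x := by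
    intro x hx
    obtain ⟨hux, hgx⟩ := hu x hx
    -- A neighborhood of a nonzero supremum contains an interval `(l, sup]`, so a Scott-open
    -- condition suffices; at zero every `e k x` vanishes.
    by_cases h0 : (⨆ k ∈ C, e k x) = 0
    · refine ⟨univ, isOpen_univ, by simpa using hC.nonempty, fun k hk => ?_⟩
      have : e k x = 0 := by
        rw [← nonpos_iff_eq_zero, ← h0]
        exact le_iSup₂ (f := fun k (_ : k ∈ C) => e k x) k hk.1
      rw [this, ← h0]
      exact hgx
    · obtain ⟨l, hl, hlu⟩ := exists_Ioc_subset_of_mem_nhds (hux.mem_nhds hgx)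
        ⟨0, pos_iff_ne_zero.2 h0⟩
      refine ⟨{y | l < e y x}, ht.isOpen_lt x l, ?_, fun k hk => hlu ⟨hk.2, ?_⟩⟩
      · obtain ⟨k, hk, hlk⟩ : ∃ k, ∃ _ : k ∈ C, l < e k x := by simpa only [lt_iSup_iff] using hl
        exact ⟨k, hk, hlk⟩
      · exact le_iSup₂ (f := fun k (_ : k ∈ C) => e k x) k hk.1
  choose! V hVo hVC hVu using h
  obtain ⟨k, hkC, hk⟩ := isIrreducible_iff_sInter.1 hC (J.image V) (by simpa using hVo)
    (by simpa using hVC)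
  refine ⟨e k, hJ fun x hx => hVu x hx k ⟨hkC, hk _ ?_⟩, k, hkC, rfl⟩
  exact Finset.mem_coe.2 (Finset.mem_image_of_mem V hx)

/-- The image of a closed subset of the cube `[0, ∞]^ι` under the retraction `approxSup R` is
stably compact. -/
theorem isStablyCompact [Nonempty Y] (ht : IsWeakScott Y e)
    (he : Function.Injective e)
    {R : ι → ι → Prop} {A : Set (ι → ℝ≥0∞)} (hA : IsClosed A) (heA : ∀ y, e y ∈ A)
    (hfix : ∀ y, approxSup R (e y) = e y) (hret : ∀ f ∈ A, ∃ y, e y = approxSup R f) :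
    IsStablyCompact Y := by
  obtain ⟨ρ, hρ⟩ : ∃ ρ : (ι → ℝ≥0∞) → Y, ∀ f ∈ A, e (ρ f) = approxSup R f := by
    choose! ρ hρ using hret
    exact ⟨ρ, hρ⟩
  have hρe : ∀ y, ρ (e y) = y := fun y => he (by rw [hρ _ (heA y), hfix])
  refine ⟨⟨fun y z h => ?_⟩, ⟨fun {C} hC hCc => ?_⟩, ⟨fun y n hn => ?_⟩,
    fun K L hK hK' hL hL' => ?_, ⟨?_⟩⟩
  · exact he (le_antisymm (ht.specializes_iff.1 h.specializes')
      (ht.specializes_iff.1 h.specializes))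
  -- Sobriety: the retraction fixes the pointwise supremum of `C`, which therefore gives the generic
  -- point.
  · set g : ι → ℝ≥0∞ := fun x => ⨆ k ∈ C, e k x with hg
    have hgA : g ∈ A :=
      closure_minimal (image_subset_iff.2 fun k _ => heA k) hA (ht.iSup_mem_closure_image hC)
    have hle : ∀ k ∈ C, e k ≤ g := fun k hk x =>
      le_iSup₂ (f := fun k (_ : k ∈ C) => e k x) k hk
    have hge : e (ρ g) = g := by
      rw [hρ g hgA]
      refine le_antisymm (fun x => iSup₂_le fun y hy => iSup₂_le fun k hk => ?_)
        (fun x => iSup₂_le fun k hk => ?_)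
      · refine le_trans ?_ (hle k hk x)
        rw [← congrFun (hfix k) x]
        exact le_approxSup hy
      · rw [← congrFun (hfix k) x]
        exact approxSup_mono R (hle k hk) x
    refine ⟨ρ g, Subset.antisymm ?_ fun k hk => ?_⟩
    · refine closure_minimal (singleton_subset_iff.2 ?_) hCc
      rw [← hCc.closure_eq, ht.isTopologicalBasis.mem_closure_iff]
      rintro _ ⟨F, ⟨hF, hFs⟩, rfl⟩ hgF
      rw [inter_comm]
      have := isIrreducible_iff_sInter.1 hC hF.toFinset (fun S hS => ?_) (fun S hS => ?_)
      · simpa using this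
      · obtain ⟨x, r, -, rfl⟩ := hFs (hF.mem_toFinset.1 hS)
        exact ht.isOpen_lt x r
      · have hS' := hF.mem_toFinset.1 hS
        have hgS := hgF S hS'
        obtain ⟨x, r, -, rfl⟩ := hFs hS'
        rw [mem_ofPred_eq, hge] at hgS
        obtain ⟨k, hk, hrk⟩ : ∃ k, ∃ _ : k ∈ C, (r : ℝ≥0∞) < e k x := by
          simpa only [hg, lt_iSup_iff] using hgS
        exact ⟨k, hk, hrk⟩
    · exact specializes_iff_mem_closure.1 (ht.specializes_iff.2 (by rw [hge]; exact hle k hk))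
  -- Local compactness: each strict bound at `x` is moved to some `z` with `R z x` and relaxed to a
  -- closed one.
  · obtain ⟨_, ⟨F, ⟨hF, hFs⟩, rfl⟩, hyF, hFn⟩ := ht.isTopologicalBasis.mem_nhds_iff.1 hn
    have h : ∀ S ∈ F, ∃ z : ι, ∃ r : ℝ≥0∞, r < e y z ∧
        ∀ f ∈ A, r ≤ f z → ρ f ∈ S := by
      intro S hS
      have hyS := hyF S hS
      obtain ⟨x, r, -, rfl⟩ := hFs hS
      rw [mem_ofPred_eq, ← hfix y, lt_approxSup_iff] at hyS
      obtain ⟨z, hz, hrz⟩ := hyS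
      obtain ⟨s, hrs, hsz⟩ := exists_between hrz
      refine ⟨z, s, hsz, fun f hf hsf => ?_⟩
      rw [mem_ofPred_eq, hρ f hf]
      exact hrs.trans_le (hsf.trans (le_approxSup hz))
    choose z r hry hr using h
    have hQ : IsClosed (A ∩ ⋂ S : F, {f : ι → ℝ≥0∞ | r S S.2 ≤ f (z S S.2)}) :=
      hA.inter (isClosed_iInter fun S =>
        isClosed_le continuous_const (continuous_apply (z S S.2)))
    refine ⟨ρ '' _, ?_, ?_, ht.isCompact_image hQ.isCompact fun f hf => hρ f hf.1⟩
    · have hN : (⋂ S : F, {w : Y | r S S.2 < e w (z S S.2)}) ∈ 𝓝 y :=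
        have := hF.to_subtype
        Filter.iInter_mem.2 fun S => (ht.isOpen_lt _ _).mem_nhds (hry S S.2)
      refine Filter.mem_of_superset hN fun w hw => ⟨e w, ⟨heA w, ?_⟩, hρe w⟩
      exact mem_iInter.2 fun S => (mem_iInter.1 hw S).out.le
    · rintro _ ⟨f, ⟨hfA, hf⟩, rfl⟩
      exact hFn fun S hS => hr S hS f hfA (mem_iInter.1 hf ⟨S, hS⟩)
  -- Coherence: `K ∩ L` is the image of the part of `A` above both `K` and `L` in the cube.
  · have hmem : ∀ M : Set Y, nhdsKer M = M → ∀ f ∈ A, (∃ k ∈ M, e k ≤ f) → ρ f ∈ M := by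
      rintro M hM f hf ⟨k, hk, hkf⟩
      rw [← hM, mem_nhdsKer_iff_specializes]
      refine ⟨k, hk, ht.specializes_iff.2 ?_⟩
      rw [hρ f hf, ← hfix k]
      exact approxSup_mono R hkf
    have hQ := (hA.inter (ht.isClosed_upper hK)).inter (ht.isClosed_upper hL)
    convert ht.isCompact_image hQ.isCompact fun f hf => hρ f hf.1.1
    ext w
    constructor
    · rintro ⟨hwK, hwL⟩
      exact ⟨e w, ⟨⟨heA w, w, hwK, le_rfl⟩, w, hwL, le_rfl⟩, hρe w⟩
    · rintro ⟨f, ⟨⟨hfA, hfK⟩, hfL⟩, rfl⟩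
      exact ⟨hmem K hK' f hfA hfK, hmem L hL' f hfA hfL⟩
  · rw [← eq_univ_of_forall fun y => (⟨e y, heA y, hρe y⟩ : y ∈ ρ '' A)]
    exact ht.isCompact_image hA.isCompact hρ

end IsWeakScott

end WeakRetract

/-- Multiplication by `∞` is discontinuous at `0`, but it is the supremum of the continuous
multiplications by `min s n`. -/
theorem ENNReal.lowerSemicontinuous_mul_right {X : Type*} [TopologicalSpace X] {f : X → ℝ≥0∞}
    (hf : Continuous f) (s : ℝ≥0∞) :
    LowerSemicontinuous fun x => f x * s := by
  have h : (fun x => f x * s) = fun x => ⨆ n : ℕ, f x * min s n := by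
    ext x
    rw [← ENNReal.mul_iSup, ← inf_iSup_eq, ENNReal.iSup_natCast, inf_top_eq]
  rw [h]
  refine lowerSemicontinuous_iSup fun n => Continuous.lowerSemicontinuous ?_
  exact (ENNReal.continuous_mul_const
    (ne_of_lt ((min_le_right _ _).trans_lt (ENNReal.natCast_lt_top n)))).comp hf

/-! ### Regularization of monotone affine maps -/

namespace BarycentricAlgebra

theorem mix_zero {B : Type*} [BarycentricAlgebra B] (x y : B) : mix 0 x y = y := by
  rw [mix_symm, unitInterval.symm_zero, mix_one]

/-- Reduces linearity to one closed condition on a coordinate. -/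
theorem isLinearMap_iff {B : Type*} [BarycentricAlgebra B] {bot : B} {f : B → ℝ≥0∞} :
    IsLinearMap bot f ↔ IsAffineMap f ∧ f bot = 0 := by
  refine and_congr_right fun hf => ⟨fun h => ?_, fun h a x => by rw [hf, h, mul_zero, add_zero]⟩
  simpa [mix_zero] using h 0 bot

variable {B : Type*} [TopologicalSpace B] [BarycentricAlgebra B]

/-- The point `x` is interior to the set of points above `z`. -/
def IsInteriorBelow {X : Type*} [TopologicalSpace X] (z x : X) : Prop :=
  x ∈ interior {w : X | w ⤳ z}

/-- The affine maps that are monotone for the specialization preorder. -/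
def affineMonotone (B : Type*) [TopologicalSpace B] [BarycentricAlgebra B] : Set (B → ℝ≥0∞) :=
  {f | IsAffineMap f ∧ ∀ x y : B, x ⤳ y → f y ≤ f x}

theorem isClosed_affineMonotone : IsClosed (affineMonotone B) := by
  refine IsClosed.inter ?_ ?_
  · change IsClosed {f : B → ℝ≥0∞ | ∀ a x y, _ = _}
    simp only [ofPred_forall]
    refine isClosed_iInter fun a => isClosed_iInter fun x => isClosed_iInter fun y => ?_
    refine isClosed_eq (continuous_apply _) (Continuous.add ?_ ?_)
    · exact (ENNReal.continuous_const_mul ENNReal.ofReal_ne_top).comp (continuous_apply x)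
    · exact (ENNReal.continuous_const_mul ENNReal.ofReal_ne_top).comp (continuous_apply y)
  · change IsClosed {f : B → ℝ≥0∞ | ∀ x y, x ⤳ y → f y ≤ f x}
    simp only [ofPred_forall]
    exact isClosed_iInter fun x => isClosed_iInter fun y => isClosed_iInter fun _ =>
      isClosed_le (continuous_apply _) (continuous_apply _)

theorem _root_.LowerSemicontinuous.le_of_specializes {X : Type*} [TopologicalSpace X]
    {f : X → ℝ≥0∞} (hf : LowerSemicontinuous f) {x y : X} (h : x ⤳ y) : f y ≤ f x :=
  le_of_forall_lt fun r hr => h.mem_open (hf.isOpen_preimage r) hr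

theorem lowerSemicontinuous_approxSup {X : Type*} [TopologicalSpace X] (f : X → ℝ≥0∞) :
    LowerSemicontinuous (approxSup IsInteriorBelow f) := by
  refine lowerSemicontinuous_iff_isOpen_preimage.2 fun r => isOpen_iff_mem_nhds.2 fun x hx => ?_
  obtain ⟨y, hy, hr⟩ := lt_approxSup_iff.1 hx
  exact Filter.mem_of_superset (isOpen_interior.mem_nhds hy)
    fun w hw => lt_approxSup_iff.2 ⟨y, hw, hr⟩

theorem approxSup_le {X : Type*} [TopologicalSpace X] {f : X → ℝ≥0∞}
    (hf : ∀ x y : X, x ⤳ y → f y ≤ f x) : approxSup IsInteriorBelow f ≤ f :=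
  fun x => iSup₂_le fun y hy => hf x y (interior_subset hy)

theorem approxSup_eq_self {X : Type*} [TopologicalSpace X] (hc : IsCSpace X) {f : X → ℝ≥0∞}
    (hf : LowerSemicontinuous f) : approxSup IsInteriorBelow f = f := by
  refine le_antisymm (approxSup_le fun x y h => hf.le_of_specializes h) fun x => ?_
  refine le_of_forall_lt fun r hr => ?_
  obtain ⟨y, hy, hxy⟩ := hc x _ (hf.isOpen_preimage r) hr
  exact lt_approxSup_iff.2 ⟨y, hxy, hy⟩

theorem approxSup_mix_le [IsSemitopological B] (hc : IsCSpace B) {f : B → ℝ≥0∞}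
    (hf : f ∈ affineMonotone B) (a : I) (x y : B) :
    approxSup IsInteriorBelow f (mix a x y) ≤
      ENNReal.ofReal a * approxSup IsInteriorBelow f x +
        ENNReal.ofReal (1 - a) * approxSup IsInteriorBelow f y := by
  refine iSup₂_le fun z hz => ?_
  -- Replacing `x` first and then `y` needs only separate continuity.
  obtain ⟨x', hx', hxx'⟩ := hc x _
    (isOpen_interior.preimage (IsSemitopological.continuous_left a y)) hz
  obtain ⟨y', hy', hyy'⟩ := hc y _
    (isOpen_interior.preimage (IsSemitopological.continuous_right a x')) hx'
  calc f z ≤ f (mix a x' y') := hf.2 _ _ (interior_subset hy')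
    _ = _ := hf.1 a x' y'
    _ ≤ _ := by
      gcongr
      · exact le_approxSup hxx'
      · exact le_approxSup hyy'

/-- Consistency requires an open set of weights, so `a` is thickened to all weights `b` for which
the combination still exceeds `r`. -/
theorem le_approxSup_mix (hcons : IsConsistent B) (hc : IsCSpace B) {f : B → ℝ≥0∞}
    (hf : f ∈ affineMonotone B) {a : I} {x y x' y' : B} (hx : IsInteriorBelow x' x)
    (hy : IsInteriorBelow y' y) :
    ENNReal.ofReal a * f x' + ENNReal.ofReal (1 - a) * f y' ≤
      approxSup IsInteriorBelow f (mix a x y) := by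
  refine le_of_forall_lt fun r hr => ?_
  have hlsc : LowerSemicontinuous fun b : I =>
      ENNReal.ofReal b * f x' + ENNReal.ofReal (1 - b) * f y' :=
    (ENNReal.lowerSemicontinuous_mul_right (ENNReal.continuous_ofReal.comp (by fun_prop)) _).add
      (ENNReal.lowerSemicontinuous_mul_right (ENNReal.continuous_ofReal.comp (by fun_prop)) _)
  have hmem : mix a x y ∈ nhdsKer (mixSet {b : I | r < ENNReal.ofReal b * f x' +
      ENNReal.ofReal (1 - b) * f y'} (interior {w | w ⤳ x'}) (interior {w | w ⤳ y'})) :=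
    subset_nhdsKer ⟨x, hx, y, hy, a, hr, rfl⟩
  obtain ⟨z, hz, hzm⟩ := hc _ _
    (hcons _ _ _ isOpen_interior isOpen_interior (hlsc.isOpen_preimage r)) hmem
  obtain ⟨_, ⟨u, hu, v, hv, b, hb, rfl⟩, hzs⟩ := mem_nhdsKer_iff_specializes.1 hz
  refine lt_approxSup_iff.2 ⟨z, hzm, lt_of_lt_of_le hb ?_⟩
  calc
    ENNReal.ofReal b * f x' + ENNReal.ofReal (1 - b) * f y' ≤
        ENNReal.ofReal b * f u + ENNReal.ofReal (1 - b) * f v := by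
        gcongr
        · exact hf.2 _ _ (interior_subset hu)
        · exact hf.2 _ _ (interior_subset hv)
    _ = f (mix b u v) := (hf.1 b u v).symm
    _ ≤ f z := hf.2 _ _ hzs

theorem isAffineMap_approxSup [IsSemitopological B] (hcons : IsConsistent B) (hc : IsCSpace B)
    {f : B → ℝ≥0∞} (hf : f ∈ affineMonotone B) : IsAffineMap (approxSup IsInteriorBelow f) := by
  intro a x y
  refine le_antisymm (approxSup_mix_le hc hf a x y) ?_
  -- Both index sets must be nonempty for a sum of suprema to be bounded by joint sums.
  obtain ⟨x₀, -, hx₀⟩ := hc x univ isOpen_univ trivial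
  obtain ⟨y₀, -, hy₀⟩ := hc y univ isOpen_univ trivial
  have hnx : Nonempty {x' : B // IsInteriorBelow x' x} := ⟨x₀, hx₀⟩
  have hny : Nonempty {y' : B // IsInteriorBelow y' y} := ⟨y₀, hy₀⟩
  have h : ∀ w : B, approxSup IsInteriorBelow f w =
      ⨆ w' : {w' : B // IsInteriorBelow w' w}, f w' := fun w => iSup_subtype'
  rw [h x, h y, ENNReal.mul_iSup, ENNReal.mul_iSup]
  exact ENNReal.iSup_add_iSup_le fun x' y' => le_approxSup_mix hcons hc hf x'.2 y'.2

instance : Nonempty (AffineDual B) :=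
  ⟨⟨0, fun _ _ _ => by simp, lowerSemicontinuous_const⟩⟩

instance (bot : B) : Nonempty (LinearDual B bot) :=
  ⟨⟨0, ⟨fun _ _ _ => by simp, fun _ _ => by simp⟩, lowerSemicontinuous_const⟩⟩

theorem isStablyCompact_affineDual [IsSemitopological B] (hcons : IsConsistent B)
    (hc : IsCSpace B) : IsStablyCompact (AffineDual B) :=
  IsWeakScott.isStablyCompact (e := fun f : AffineDual B => f.1) rfl Subtype.val_injective
    isClosed_affineMonotone (fun f => ⟨f.2.1, fun _ _ h => f.2.2.le_of_specializes h⟩)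
    (fun f => approxSup_eq_self hc f.2.2)
    fun f hf => ⟨⟨_, isAffineMap_approxSup hcons hc hf, lowerSemicontinuous_approxSup f⟩, rfl⟩

theorem isStablyCompact_linearDual [IsSemitopological B] (hcons : IsConsistent B)
    (hc : IsCSpace B) (bot : B) : IsStablyCompact (LinearDual B bot) :=
  IsWeakScott.isStablyCompact (e := fun f : LinearDual B bot => f.1) rfl Subtype.val_injective
    (isClosed_affineMonotone.inter (isClosed_singleton.preimage (continuous_apply bot)))
    (fun f => ⟨⟨f.2.1.1, fun _ _ h => f.2.2.le_of_specializes h⟩, (isLinearMap_iff.1 f.2.1).2⟩)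
    (fun f => approxSup_eq_self hc f.2.2)
    fun f hf => ⟨⟨_, isLinearMap_iff.2 ⟨isAffineMap_approxSup hcons hc hf.1,
      le_antisymm ((approxSup_le hf.1.2 bot).trans_eq hf.2) zero_le⟩,
      lowerSemicontinuous_approxSup f⟩, rfl⟩

end BarycentricAlgebra

theorem mainTheorem9 (B : Type*) [TopologicalSpace B] [BarycentricAlgebra B]
    [BarycentricAlgebra.IsSemitopological B]
    (hcons : BarycentricAlgebra.IsConsistent B) (hc : IsCSpace B) :
    IsStablyCompact (BarycentricAlgebra.AffineDual B) ∧
      ∀ bot : B, BarycentricAlgebra.IsPoint bot →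
        IsStablyCompact (BarycentricAlgebra.LinearDual B bot) :=
  ⟨BarycentricAlgebra.isStablyCompact_affineDual hcons hc,
    fun bot _ => BarycentricAlgebra.isStablyCompact_linearDual hcons hc bot⟩
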